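/- Let $K$ be a field, let $1\le k$ and $j\le n$ be natural numbers, and let $R=K[x_1,\dots,x_n]$. For $m\in\mathbb N$ let $I_{m,n}\subseteq R$ be the ideal generated by all products $\prod_{s\in\sigma}x_s$ with $\sigma\subseteq\{1,\dots,n\}$, $|\sigma|=m$ (the failure ideal of the $m$-out-of-$n$:F system). Let $I_{k,n,i}$ be the $i$-fold lcm-ideal of $I_{k,n}$, that is, the ideal generated by the least common multiples of all sets of $i$ distinct minimal monomial generators of $I_{k,n}$. Let $$\binom{j-1}{k}<i\le\binom{j}{k}.$$ Then the following holds both for $I=I_{k,n,i}$ and for $I=I_{j,n}$. 1. $I$ has a $j$-linear resolution: it has a minimal graded free resolution, in which all generators in homological degree $a$ have degree $a+j$, for each $a\ge 0$. 2. The graded Betti numbers of $I$ (the numbers $\beta_{a,b}(I)$ of generators of degree $b$ in homological degree $a$ of a minimal $\mathbb N$-graded free resolution of $I$) are $$\beta_{a,a+j}(I)=\binom{n}{j+a}\binom{a+j-1}{j-1}\qquad(0\le a\le n-j),$$ and all other graded Betti numbers $\beta_{a,b}(I)$ are zero. 3. The multigraded Betti numbers of $I$ (the numbers $\beta_{a,\alpha}(I)$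 of generators of multidegree $\alpha\in\mathbb N^n$ in homological degree $a$ of a minimal $\mathbb N^n$-graded free resolution of $I$) are $$\beta_{a,\alpha}(I)=\binom{a+j-1}{j-1}$$ if $x^\alpha$ is a product of $a+j$ distinct variables, and zero otherwise. -/

import Mathlib

/-- The exponent vectors of the minimal monomial generators of a monomial ideal `I`: the minimal
elements, for divisibility (the componentwise order on exponents), among the monomials of `I`. -/
def minMonomialGens {σ K : Type*} [Field K] (I : Ideal (MvPolynomial σ K)) : Set (σ →₀ ℕ) :=
  {α | Minimal (fun β : σ →₀ ℕ => MvPolynomial.monomial β (1 : K) ∈ I) α}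

/-- The `i`-fold lcm-ideal of a monomial ideal `I`: it is generated by the least common multiples
of all sets of `i` distinct minimal monomial generators of `I`. The exponent vector of the lcm of
monomials is the componentwise maximum of their exponent vectors. -/
noncomputable def lcmIdeal {σ K : Type*} [Field K] (I : Ideal (MvPolynomial σ K)) (i : ℕ) :
    Ideal (MvPolynomial σ K) :=
  Ideal.span {p | ∃ s : Finset (σ →₀ ℕ), (s : Set (σ →₀ ℕ)) ⊆ minMonomialGens I ∧
    s.card = i ∧ p = MvPolynomial.monomial (s.sup id) (1 : K)}

/-- The failure ideal of the `k`-out-of-`n`:F system: it is generated by the products of `k`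
distinct variables. -/
noncomputable def kOutOfNIdeal (K : Type*) [Field K] (n k : ℕ) : Ideal (MvPolynomial (Fin n) K) :=
  Ideal.span {p | ∃ s : Finset (Fin n), s.card = k ∧ p = ∏ t ∈ s, MvPolynomial.X t}

/-- A minimal graded free resolution `⋯ → F₂ → F₁ → F₀ → I → 0` of an ideal `I` of a polynomial
ring, for the grading in which the variable `X t` has degree `w t`. The module `F a` is free with
a basis of `rank a` elements, and the basis element `b` has degree `deg a b`. -/
structure MinimalGradedFreeResolution {σ K M : Type*} [Field K] [AddCommMonoid M] (w : σ → M)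
    (I : Ideal (MvPolynomial σ K)) where
  /-- the rank of `F a` -/
  rank : ℕ → ℕ
  /-- the degrees of the basis elements -/
  deg : ∀ a, Fin (rank a) → M
  /-- the augmentation onto `I` -/
  ε : (Fin (rank 0) → MvPolynomial σ K) →ₗ[MvPolynomial σ K] MvPolynomial σ K
  /-- the differentials -/
  d : ∀ a, (Fin (rank (a + 1)) → MvPolynomial σ K) →ₗ[MvPolynomial σ K]
    (Fin (rank a) → MvPolynomial σ K)
  range_ε : LinearMap.range ε = I
  exact_zero : LinearMap.ker ε = LinearMap.range (d 0)
  exact_succ : ∀ a, LinearMap.ker (d a) = LinearMap.range (d (a + 1))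
  /-- the augmentation preserves degrees -/
  homogeneous_ε : ∀ b : Fin (rank 0),
    MvPolynomial.IsWeightedHomogeneous w (ε (Pi.single b 1)) (deg 0 b)
  /-- the differentials preserve degrees: in the coefficient of a basis element `c` in `d a e_b`,
  each monomial has a degree which together with that of `c` gives the degree of `b` -/
  homogeneous_d : ∀ (a : ℕ) (b : Fin (rank (a + 1))) (c : Fin (rank a)) (e : σ →₀ ℕ),
    MvPolynomial.coeff e (d a (Pi.single b 1) c) ≠ 0 →
      Finsupp.weight w e + deg a c = deg (a + 1) b
  /-- minimality: the image of each differential lies in `(X t : t) • F a` -/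
  minimal : ∀ (a : ℕ) (v : Fin (rank (a + 1)) → MvPolynomial σ K) (c : Fin (rank a)),
    MvPolynomial.constantCoeff (d a v c) = 0

/-- The number of basis elements of degree `m` in homological degree `a`. -/
noncomputable def MinimalGradedFreeResolution.numGens {σ K M : Type*} [Field K] [AddCommMonoid M]
    {w : σ → M} {I : Ideal (MvPolynomial σ K)} (F : MinimalGradedFreeResolution w I)
    (a : ℕ) (m : M) : ℕ :=
  Nat.card {b : Fin (F.rank a) // F.deg a b = m}

/-- The Betti number of `I` in homological degree `a` and degree `m`, for the grading given by
the weights `w`, is equal to `c`: the ideal `I` has a minimal graded free resolution, and each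
minimal graded free resolution of `I` has in homological degree `a` exactly `c` generators of
degree `m`. -/
def HasBettiNumber {σ K M : Type*} [Field K] [AddCommMonoid M] (w : σ → M)
    (I : Ideal (MvPolynomial σ K)) (a : ℕ) (m : M) (c : ℕ) : Prop :=
  Nonempty (MinimalGradedFreeResolution w I) ∧
    ∀ F : MinimalGradedFreeResolution w I, F.numGens a m = c

/-- The standard grading: each variable has degree `1`. -/
def stdWeight (n : ℕ) : Fin n → ℕ := fun _ => 1

/-- The multigrading: the variable `X t` has as its degree the `t`-th unit vector. -/
noncomputable def multiWeight (n : ℕ) : Fin n → (Fin n →₀ ℕ) := fun t => Finsupp.single t 1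

/-- The graded Betti number `β_{a,b}(I)` is equal to `c`. -/
def HasGradedBetti {K : Type*} [Field K] {n : ℕ} (I : Ideal (MvPolynomial (Fin n) K))
    (a b c : ℕ) : Prop :=
  HasBettiNumber (stdWeight n) I a b c

/-- The multigraded Betti number `β_{a,α}(I)` is equal to `c`. -/
def HasMultigradedBetti {K : Type*} [Field K] {n : ℕ} (I : Ideal (MvPolynomial (Fin n) K))
    (a : ℕ) (α : Fin n →₀ ℕ) (c : ℕ) : Prop :=
  HasBettiNumber (multiWeight n) I a α c

/-- The ideal `I` has a `j`-linear resolution: it has a minimal graded free resolution for the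
standard grading, and in each of them all generators in homological degree `a` have degree
`a + j`. -/
def HasLinearResolution {K : Type*} [Field K] {n : ℕ} (I : Ideal (MvPolynomial (Fin n) K))
    (j : ℕ) : Prop :=
  Nonempty (MinimalGradedFreeResolution (stdWeight n) I) ∧
    ∀ (F : MinimalGradedFreeResolution (stdWeight n) I) (a : ℕ) (b : Fin (F.rank a)), F.deg a b = a + j

/-- The multidegree of the product of the variables `X t` with `t ∈ s`. -/
noncomputable def squarefreeDegree {n : ℕ} (s : Finset (Fin n)) : Fin n →₀ ℕ :=
  ∑ t ∈ s, Finsupp.single t 1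

/-!
By taking unions of index sets, an lcm of `i` generators of the `k`-out-of-`n` ideal is the product
of the variables in a union of `i` sets of cardinality `k`. The bounds on `i` force such unions to
have at least `j` elements, and each set with `j` elements is one of them, so that the lcm-ideal is
the `j`-out-of-`n` ideal itself (`lcmIdeal_kOutOfNIdeal`). It remains to treat the latter, the
squarefree Veronese ideal `I_{j,T}` on the set `T` of all variables.

*Existence of the resolution.* For a variable `x` outside of `T` one has
`I_{j+1,T ∪ {x}} = x I_{j,T} + I_{j+1,T}`, where the two summands intersect in `x I_{j+1,T}`. If `F`
and `G` are minimal multigraded resolutions of `I_{j+1,T}` and `I_{j,T}`, then the mapping cone of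
the map from `F` to `G ⊕ F` whose components are a lift of the inclusion and the multiplication by
`x` resolves the sum (`IndexedResolution.cone`). It is minimal, because the generators of `F` and
`G` in the same homological degree have different degrees. The numbers of generators satisfy the
recursion of `Nat.multichoose`, which yields the multigraded Betti numbers
(`exists_resolution_squarefreeVeronese`). Passing to total degrees gives the standard grading.

*Independence of the resolution.* Graded lifts between two minimal resolutions compose to a map
that is homotopic to the identity. By minimality the homotopy has no effect on constant terms, so
that the matrices of constant terms of the lifts, which only connect generators of equal degree,
are inverse to each other on one side (`MinimalGradedFreeResolution.exists_comparison`,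
`card_le_of_comp_eq_id_mod`). Hence the number of generators of each degree is the same in all
minimal resolutions (`hasBettiNumber_of_resolution`).
-/

open MvPolynomial

/-! ### Homogeneous vectors and graded maps between free modules -/

/-- The vectors of degree `m` in the graded free module with basis elements of degrees `δ`: in the
coordinate `c`, each monomial has a degree which together with `δ c` gives `m`. -/
def homogeneousVectors {σ K M A : Type*} [Field K] [AddCommMonoid M] (w : σ → M) (δ : A → M)
    (m : M) : Submodule K (A → MvPolynomial σ K) where
  carrier := {v | ∀ c e, coeff e (v c) ≠ 0 → Finsupp.weight w e + δ c = m}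
  add_mem' := by
    intro u v hu hv c e h
    by_cases h1 : coeff e (u c) = 0
    · exact hv c e (by simpa [h1] using h)
    · exact hu c e h1
  zero_mem' := by
    intro c e h
    simp at h
  smul_mem' := by
    intro r v hv c e h
    refine hv c e fun h0 => h ?_
    simp [h0]

/-- A linear map between graded free modules is graded if it preserves the degrees of homogeneous
vectors. -/
def IsGradedMap {σ K M A B : Type*} [Field K] [AddCommMonoid M] (w : σ → M) (δA : A → M)
    (δB : B → M) (f : (A → MvPolynomial σ K) →ₗ[MvPolynomial σ K] (B → MvPolynomial σ K)) : Prop :=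
  ∀ m, ∀ v ∈ homogeneousVectors w δA m, f v ∈ homogeneousVectors w δB m

theorem single_mem_homogeneousVectors {σ K M A : Type*} [Field K] [AddCommMonoid M]
    [DecidableEq A] (w : σ → M) (δ : A → M) (a : A) (e : σ →₀ ℕ) (r : K) :
    (Pi.single a (monomial e r) : A → MvPolynomial σ K) ∈
      homogeneousVectors w δ (Finsupp.weight w e + δ a) := by
  classical
  intro c e' h
  by_cases hc : c = a
  · subst hc
    rw [Pi.single_eq_same, coeff_monomial] at h
    by_cases he : e = e'
    · rw [he]
    · simp [he] at h
  · simp [Pi.single_eq_of_ne hc] at h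

theorem single_one_mem_homogeneousVectors {σ K M A : Type*} [Field K] [AddCommMonoid M]
    [DecidableEq A] (w : σ → M) (δ : A → M) (a : A) :
    (Pi.single a 1 : A → MvPolynomial σ K) ∈ homogeneousVectors w δ (δ a) := by
  simpa using single_mem_homogeneousVectors (K := K) w δ a 0 1

theorem apply_eq_sum_single {R A B : Type*} [CommSemiring R] [Fintype A] [DecidableEq A]
    (f : (A → R) →ₗ[R] (B → R)) (v : A → R) (c : B) :
    f v c = ∑ a, v a * f (Pi.single a 1) c := by
  conv_lhs => rw [← Finset.univ_sum_single v]
  rw [map_sum, Finset.sum_apply]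
  refine Finset.sum_congr rfl fun a _ => ?_
  rw [show (Pi.single a (v a) : A → R) = v a • Pi.single a 1 by
    rw [← Pi.single_smul, smul_eq_mul, mul_one], map_smul, Pi.smul_apply, smul_eq_mul]

theorem isGradedMap_iff {σ K M A B : Type*} [Field K] [AddCommMonoid M] [Fintype A]
    [DecidableEq A] {w : σ → M} {δA : A → M} {δB : B → M}
    {f : (A → MvPolynomial σ K) →ₗ[MvPolynomial σ K] (B → MvPolynomial σ K)} :
    IsGradedMap w δA δB f ↔ ∀ a c e, coeff e (f (Pi.single a 1) c) ≠ 0 →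
      Finsupp.weight w e + δB c = δA a := by
  classical
  refine ⟨fun h a => h _ _ (single_one_mem_homogeneousVectors w δA a), fun h m v hv c e he => ?_⟩
  rw [apply_eq_sum_single, coeff_sum] at he
  obtain ⟨a, -, ha⟩ := Finset.exists_ne_zero_of_sum_ne_zero he
  rw [coeff_mul] at ha
  obtain ⟨⟨e₁, e₂⟩, hmem, hne⟩ := Finset.exists_ne_zero_of_sum_ne_zero ha
  rw [Finset.HasAntidiagonal.mem_antidiagonal] at hmem
  have h₁ := hv a e₁ (left_ne_zero_of_mul hne)
  have h₂ := h a c e₂ (right_ne_zero_of_mul hne)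
  rw [← hmem, map_add, add_assoc, h₂, h₁]

theorem IsGradedMap.comp {σ K M A B C : Type*} [Field K] [AddCommMonoid M] {w : σ → M}
    {δA : A → M} {δB : B → M} {δC : C → M}
    {g : (B → MvPolynomial σ K) →ₗ[MvPolynomial σ K] (C → MvPolynomial σ K)}
    {f : (A → MvPolynomial σ K) →ₗ[MvPolynomial σ K] (B → MvPolynomial σ K)}
    (hg : IsGradedMap w δB δC g) (hf : IsGradedMap w δA δB f) : IsGradedMap w δA δC (g ∘ₗ f) :=
  fun m v hv => hg m _ (hf m v hv)

/-- Twisting source and target of a graded map by the same degree keeps it graded. -/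
theorem IsGradedMap.shift {σ K M A B : Type*} [Field K] [AddCommMonoid M] [Fintype A]
    {w : σ → M} {δA : A → M} {δB : B → M}
    {f : (A → MvPolynomial σ K) →ₗ[MvPolynomial σ K] (B → MvPolynomial σ K)}
    (hf : IsGradedMap w δA δB f) (s : M) :
    IsGradedMap w (fun a => δA a + s) (fun b => δB b + s) f := by
  classical
  rw [isGradedMap_iff] at hf ⊢
  intro a c e h
  rw [← add_assoc, hf a c e h]

/-- The projection of a graded free module onto its vectors of degree `m`. -/
noncomputable def homogeneousProj {σ K M A : Type*} [Field K] [AddCommMonoid M] (w : σ → M)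
    (δ : A → M) (m : M) : (A → MvPolynomial σ K) →ₗ[K] (A → MvPolynomial σ K) := by
  classical
  exact LinearMap.pi fun c => ((basisMonomials σ K).constr K fun e =>
    if Finsupp.weight w e + δ c = m then monomial e (1 : K) else 0) ∘ₗ LinearMap.proj c

theorem coeff_homogeneousProj {σ K M A : Type*} [Field K] [AddCommMonoid M] [DecidableEq M]
    (w : σ → M) (δ : A → M) (m : M) (v : A → MvPolynomial σ K) (c : A) (e : σ →₀ ℕ) :
    coeff e (homogeneousProj w δ m v c) =
      if Finsupp.weight w e + δ c = m then coeff e (v c) else 0 := by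
  classical
  simp only [homogeneousProj, LinearMap.pi_apply, LinearMap.comp_apply, LinearMap.proj_apply]
  induction v c using MvPolynomial.induction_on' with
  | monomial u r =>
    rw [show (monomial u r : MvPolynomial σ K) = r • basisMonomials σ K u by
      simp [smul_monomial], map_smul, Module.Basis.constr_basis]
    by_cases hu : u = e
    · subst hu
      by_cases h : Finsupp.weight w u + δ c = m <;> simp [h]
    · by_cases h : Finsupp.weight w u + δ c = m <;> simp [h, hu, coeff_monomial]
  | add p q hp hq =>
    rw [map_add, coeff_add, hp, hq, coeff_add]
    split_ifs <;> simp

theorem homogeneousProj_mem {σ K M A : Type*} [Field K] [AddCommMonoid M]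
    (w : σ → M) (δ : A → M) (m : M) (v : A → MvPolynomial σ K) :
    homogeneousProj w δ m v ∈ homogeneousVectors w δ m := by
  classical
  intro c e h
  rw [coeff_homogeneousProj] at h
  by_contra h'
  simp [h'] at h

theorem homogeneousProj_of_mem {σ K M A : Type*} [Field K] [AddCommMonoid M] [DecidableEq M]
    {w : σ → M} {δ : A → M} {m m' : M} {v : A → MvPolynomial σ K}
    (hv : v ∈ homogeneousVectors w δ m') :
    homogeneousProj w δ m v = if m' = m then v else 0 := by
  ext c e
  rw [coeff_homogeneousProj]
  by_cases h : coeff e (v c) = 0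
  · split_ifs <;> simp [h]
  · rw [hv c e h]
    split_ifs <;> simp

theorem IsGradedMap.homogeneousProj_comm {σ K M A B : Type*} [Field K] [AddCommMonoid M]
    [Fintype A] {w : σ → M} {δA : A → M} {δB : B → M}
    {f : (A → MvPolynomial σ K) →ₗ[MvPolynomial σ K] (B → MvPolynomial σ K)}
    (hf : IsGradedMap w δA δB f) (m : M) (v : A → MvPolynomial σ K) :
    f (homogeneousProj w δA m v) = homogeneousProj w δB m (f v) := by
  classical
  suffices h : f.restrictScalars K ∘ₗ homogeneousProj w δA m =
      homogeneousProj w δB m ∘ₗ f.restrictScalars K from LinearMap.congr_fun h v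
  refine LinearMap.pi_ext' fun a => MvPolynomial.linearMap_ext fun e => LinearMap.ext fun r => ?_
  have h := single_mem_homogeneousVectors w δA a e r
  simp only [LinearMap.comp_apply, LinearMap.single_apply, LinearMap.restrictScalars_apply]
  change f (homogeneousProj w δA m (Pi.single a (monomial e r))) =
    homogeneousProj w δB m (f (Pi.single a (monomial e r)))
  rw [homogeneousProj_of_mem h, homogeneousProj_of_mem (hf _ _ h)]
  split_ifs <;> simp

theorem IsGradedMap.exists_homogeneous_preimage {σ K M A B : Type*} [Field K] [AddCommMonoid M]
    [Fintype A] {w : σ → M} {δA : A → M} {δB : B → M}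
    {f : (A → MvPolynomial σ K) →ₗ[MvPolynomial σ K] (B → MvPolynomial σ K)}
    (hf : IsGradedMap w δA δB f) {m : M} {y : B → MvPolynomial σ K}
    (hy : y ∈ homogeneousVectors w δB m) (hy' : y ∈ LinearMap.range f) :
    ∃ v ∈ homogeneousVectors w δA m, f v = y := by
  classical
  obtain ⟨v, rfl⟩ := hy'
  refine ⟨homogeneousProj w δA m v, homogeneousProj_mem w δA m v, ?_⟩
  rw [hf.homogeneousProj_comm, homogeneousProj_of_mem hy, if_pos rfl]

/-- Graded free modules are projective in the graded sense: a graded map into the range of a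
graded map lifts to a graded map. -/
theorem IsGradedMap.exists_lift {σ K M A B C : Type*} [Field K] [AddCommMonoid M]
    [Fintype A] [Fintype B] {w : σ → M} {δA : A → M} {δB : B → M} {δC : C → M}
    {g : (A → MvPolynomial σ K) →ₗ[MvPolynomial σ K] (C → MvPolynomial σ K)}
    {f : (B → MvPolynomial σ K) →ₗ[MvPolynomial σ K] (C → MvPolynomial σ K)}
    (hg : IsGradedMap w δA δC g) (hf : IsGradedMap w δB δC f)
    (h : LinearMap.range g ≤ LinearMap.range f) :
    ∃ φ : (A → MvPolynomial σ K) →ₗ[MvPolynomial σ K] (B → MvPolynomial σ K),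
      IsGradedMap w δA δB φ ∧ f ∘ₗ φ = g := by
  classical
  choose v hv hfv using fun a => hf.exists_homogeneous_preimage
    (hg _ _ (single_one_mem_homogeneousVectors w δA a)) (h (LinearMap.mem_range_self g _))
  have key : ∀ a, (Pi.basisFun (MvPolynomial σ K) A).constr (MvPolynomial σ K) v
      (Pi.single a 1) = v a := fun a => by
    rw [← Pi.basisFun_apply (MvPolynomial σ K) A a, Module.Basis.constr_basis]
  refine ⟨(Pi.basisFun (MvPolynomial σ K) A).constr (MvPolynomial σ K) v, ?_, ?_⟩
  · rw [isGradedMap_iff]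
    intro a
    rw [key]
    exact hv a
  · refine (Pi.basisFun (MvPolynomial σ K) A).ext fun a => ?_
    rw [LinearMap.comp_apply, Pi.basisFun_apply, key, hfv]

theorem exists_lift_of_range_le {R A B C : Type*} [CommRing R] [AddCommGroup A] [Module R A]
    [Module.Projective R A] [AddCommGroup B] [Module R B] [AddCommGroup C] [Module R C]
    (g : A →ₗ[R] C) (f : B →ₗ[R] C) (h : LinearMap.range g ≤ LinearMap.range f) :
    ∃ φ : A →ₗ[R] B, f ∘ₗ φ = g := by
  obtain ⟨φ, hφ⟩ := Module.projective_lifting_property f.rangeRestrict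
    (g.codRestrict (LinearMap.range f) fun x => h (LinearMap.mem_range_self g x))
    f.surjective_rangeRestrict
  exact ⟨φ, LinearMap.ext fun x => congrArg Subtype.val (LinearMap.congr_fun hφ x)⟩

/-- A map from a free module into the polynomial ring, as a map into the free module with one
basis element. It lets an augmentation be treated like a differential. -/
def augmentationMap {R A : Type*} [CommSemiring R] (ε : (A → R) →ₗ[R] R) :
    (A → R) →ₗ[R] (Unit → R) :=
  LinearMap.pi fun _ => ε

theorem range_augmentationMap_le {R A B : Type*} [CommRing R] {ε : (A → R) →ₗ[R] R}
    {ε' : (B → R) →ₗ[R] R} (h : LinearMap.range ε ≤ LinearMap.range ε') :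
    LinearMap.range (augmentationMap ε) ≤ LinearMap.range (augmentationMap ε') := by
  rintro _ ⟨v, rfl⟩
  obtain ⟨u, hu⟩ := h (LinearMap.mem_range_self ε v)
  exact ⟨u, funext fun _ => hu⟩

/-! ### Uniqueness of Betti numbers -/

theorem MinimalGradedFreeResolution.isGradedMap_augmentation {σ K M : Type*} [Field K]
    [AddCommMonoid M] {w : σ → M} {I : Ideal (MvPolynomial σ K)}
    (F : MinimalGradedFreeResolution w I) :
    IsGradedMap w (F.deg 0) (fun _ => 0) (augmentationMap F.ε) := by
  rw [isGradedMap_iff]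
  intro b c e h
  rw [add_zero]
  exact F.homogeneous_ε b h

theorem MinimalGradedFreeResolution.isGradedMap_d {σ K M : Type*} [Field K]
    [AddCommMonoid M] {w : σ → M} {I : Ideal (MvPolynomial σ K)}
    (F : MinimalGradedFreeResolution w I) (a : ℕ) :
    IsGradedMap w (F.deg (a + 1)) (F.deg a) (F.d a) :=
  isGradedMap_iff.2 (F.homogeneous_d a)

/-- A linear map between free modules over a polynomial ring maps the vectors without constant
terms to such vectors. -/
theorem constantCoeff_apply_eq_zero {σ K A B : Type*} [Field K] [Fintype A]
    (f : (A → MvPolynomial σ K) →ₗ[MvPolynomial σ K] (B → MvPolynomial σ K))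
    {v : A → MvPolynomial σ K} (hv : ∀ a, constantCoeff (v a) = 0) (c : B) :
    constantCoeff (f v c) = 0 := by
  classical
  rw [apply_eq_sum_single, map_sum]
  exact Finset.sum_eq_zero fun a _ => by rw [map_mul, hv, zero_mul]

/-- If the composition of the graded maps `φ` and `ψ` is the identity up to a map without constant
terms, then the source of `φ` has in each degree at most as many basis elements as its target. The
matrices of constant terms of `φ` and `ψ` only connect basis elements of the same degree, so that
their blocks for one degree have the identity matrix as their product. -/
theorem card_le_of_comp_eq_id_mod {σ K M A B : Type*} [Field K] [AddCommMonoid M] [Fintype A]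
    [DecidableEq A] [Fintype B] {w : σ → M} {δA : A → M} {δB : B → M}
    {φ : (A → MvPolynomial σ K) →ₗ[MvPolynomial σ K] (B → MvPolynomial σ K)}
    {ψ : (B → MvPolynomial σ K) →ₗ[MvPolynomial σ K] (A → MvPolynomial σ K)}
    (hφ : IsGradedMap w δA δB φ)
    (h : ∀ v c, constantCoeff (ψ (φ v) c) = constantCoeff (v c)) (m : M) :
    Nat.card {a // δA a = m} ≤ Nat.card {b // δB b = m} := by
  classical
  let P : Matrix {a // δA a = m} {b // δB b = m} K :=
    Matrix.of fun a b => constantCoeff (φ (Pi.single a.1 1) b.1)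
  let Q : Matrix {b // δB b = m} {a // δA a = m} K :=
    Matrix.of fun b a => constantCoeff (ψ (Pi.single b.1 1) a.1)
  have hPQ : P * Q = 1 := by
    ext a a'
    have h1 := h (Pi.single a.1 1) a'.1
    rw [apply_eq_sum_single, map_sum] at h1
    rw [Matrix.mul_apply, Matrix.one_apply]
    have h2 : ∑ b : {b // δB b = m}, P a b * Q b a' =
        ∑ b, constantCoeff (φ (Pi.single a.1 1) b * ψ (Pi.single b 1) a'.1) := by
      rw [← Finset.sum_filter_of_ne (p := fun b => δB b = m)]
      · rw [Finset.sum_subtype (Finset.univ.filter fun b => δB b = m) (p := fun b => δB b = m)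
          (by simp)]
        refine Finset.sum_congr rfl fun b _ => ?_
        rw [map_mul]
        rfl
      · intro b _ hb
        rw [map_mul] at hb
        have hd := isGradedMap_iff.1 hφ a.1 b 0 (left_ne_zero_of_mul hb)
        rw [map_zero, zero_add] at hd
        exact hd.trans a.2
    rw [h2, h1]
    by_cases haa : a = a'
    · subst haa
      simp
    · rw [if_neg haa, Pi.single_eq_of_ne (fun h => haa (Subtype.ext h.symm)), map_zero]
  rw [Nat.card_eq_fintype_card, Nat.card_eq_fintype_card]
  calc Fintype.card {a // δA a = m} = (P * Q).rank := by rw [hPQ, Matrix.rank_one]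
    _ ≤ P.rank := Matrix.rank_mul_le_left P Q
    _ ≤ _ := Matrix.rank_le_card_width P

/-- Comparison of minimal resolutions. In each homological degree `a` there are graded maps `φ`
and `ψ` between the free modules of `F` and `G`, which are the components of comparison maps. The
map `k` without constant terms is the part `h ∘ d` of a homotopy `d ∘ h + h ∘ d` between their
composition and the identity. Only the properties that the next homological degree needs are
kept. -/
theorem MinimalGradedFreeResolution.exists_comparison {σ K M : Type*} [Field K]
    [AddCommMonoid M] {w : σ → M} {I : Ideal (MvPolynomial σ K)}
    (F G : MinimalGradedFreeResolution w I) (a : ℕ) :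
    ∃ (φ : (Fin (F.rank a) → MvPolynomial σ K) →ₗ[MvPolynomial σ K]
        (Fin (G.rank a) → MvPolynomial σ K))
      (ψ : (Fin (G.rank a) → MvPolynomial σ K) →ₗ[MvPolynomial σ K]
        (Fin (F.rank a) → MvPolynomial σ K))
      (k : (Fin (F.rank a) → MvPolynomial σ K) →ₗ[MvPolynomial σ K]
        (Fin (F.rank a) → MvPolynomial σ K)),
      IsGradedMap w (F.deg a) (G.deg a) φ ∧ IsGradedMap w (G.deg a) (F.deg a) ψ ∧
      LinearMap.range (φ ∘ₗ F.d a) ≤ LinearMap.range (G.d a) ∧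
      LinearMap.range (ψ ∘ₗ G.d a) ≤ LinearMap.range (F.d a) ∧
      (∀ v c, constantCoeff (k v c) = 0) ∧ k ∘ₗ F.d a = 0 ∧
      LinearMap.range (ψ ∘ₗ φ - LinearMap.id - k) ≤ LinearMap.range (F.d a) := by
  induction a with
  | zero =>
    have hFG : LinearMap.range F.ε = LinearMap.range G.ε := F.range_ε.trans G.range_ε.symm
    obtain ⟨φ, hφ, hφ'⟩ := F.isGradedMap_augmentation.exists_lift G.isGradedMap_augmentation
      (range_augmentationMap_le hFG.le)
    obtain ⟨ψ, hψ, hψ'⟩ := G.isGradedMap_augmentation.exists_lift F.isGradedMap_augmentation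
      (range_augmentationMap_le hFG.ge)
    have h1 : ∀ v, G.ε (φ v) = F.ε v := fun v => congrFun (LinearMap.congr_fun hφ' v) ()
    have h2 : ∀ v, F.ε (ψ v) = G.ε v := fun v => congrFun (LinearMap.congr_fun hψ' v) ()
    have hF : ∀ v, F.ε (F.d 0 v) = 0 := fun v =>
      LinearMap.mem_ker.1 (F.exact_zero ▸ LinearMap.mem_range_self (F.d 0) v)
    have hG : ∀ v, G.ε (G.d 0 v) = 0 := fun v =>
      LinearMap.mem_ker.1 (G.exact_zero ▸ LinearMap.mem_range_self (G.d 0) v)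
    refine ⟨φ, ψ, 0, hφ, hψ, ?_, ?_, by simp, by simp, ?_⟩
    · rw [← G.exact_zero]
      rintro _ ⟨v, rfl⟩
      simp [h1, hF]
    · rw [← F.exact_zero]
      rintro _ ⟨v, rfl⟩
      simp [h2, hG]
    · rw [← F.exact_zero]
      rintro _ ⟨v, rfl⟩
      simp [h1, h2]
  | succ a ih =>
    obtain ⟨φ₀, ψ₀, k₀, hφ₀, hψ₀, hφr, hψr, hk₀, hk₀d, hr⟩ := ih
    obtain ⟨φ, hφ, hφ'⟩ := (hφ₀.comp (F.isGradedMap_d a)).exists_lift (G.isGradedMap_d a) hφr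
    obtain ⟨ψ, hψ, hψ'⟩ := (hψ₀.comp (G.isGradedMap_d a)).exists_lift (F.isGradedMap_d a) hψr
    obtain ⟨h, hh⟩ := exists_lift_of_range_le _ _ hr
    have h1 : ∀ v, G.d a (φ v) = φ₀ (F.d a v) := LinearMap.congr_fun hφ'
    have h2 : ∀ v, F.d a (ψ v) = ψ₀ (G.d a v) := LinearMap.congr_fun hψ'
    have h3 : ∀ v, F.d a (h v) = ψ₀ (φ₀ v) - v - k₀ v := LinearMap.congr_fun hh
    have h4 : ∀ v, k₀ (F.d a v) = 0 := LinearMap.congr_fun hk₀d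
    have hF : ∀ v, F.d a (F.d (a + 1) v) = 0 := fun v =>
      LinearMap.mem_ker.1 (F.exact_succ a ▸ LinearMap.mem_range_self (F.d (a + 1)) v)
    have hG : ∀ v, G.d a (G.d (a + 1) v) = 0 := fun v =>
      LinearMap.mem_ker.1 (G.exact_succ a ▸ LinearMap.mem_range_self (G.d (a + 1)) v)
    refine ⟨φ, ψ, h ∘ₗ F.d a, hφ, hψ, ?_, ?_, ?_, ?_, ?_⟩
    · rw [← G.exact_succ]
      rintro _ ⟨v, rfl⟩
      simp [h1, hF]
    · rw [← F.exact_succ]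
      rintro _ ⟨v, rfl⟩
      simp [h2, hG]
    · exact fun v c => constantCoeff_apply_eq_zero h (F.minimal a v) c
    · exact LinearMap.ext fun v => by simp [hF]
    · rw [← F.exact_succ]
      rintro _ ⟨v, rfl⟩
      simp [h1, h2, h3, h4]

theorem MinimalGradedFreeResolution.numGens_le {σ K M : Type*} [Field K]
    [AddCommMonoid M] {w : σ → M} {I : Ideal (MvPolynomial σ K)}
    (F G : MinimalGradedFreeResolution w I) (a : ℕ) (m : M) : F.numGens a m ≤ G.numGens a m := by
  obtain ⟨φ, ψ, k, hφ, -, -, -, hk, -, hr⟩ := F.exists_comparison G a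
  refine card_le_of_comp_eq_id_mod (ψ := ψ) hφ (fun v c => ?_) m
  obtain ⟨u, hu⟩ := hr (LinearMap.mem_range_self _ v)
  have h := congrArg constantCoeff (congrFun hu c)
  rw [F.minimal] at h
  simp only [LinearMap.sub_apply, LinearMap.comp_apply, LinearMap.id_apply, Pi.sub_apply,
    map_sub, hk, sub_zero] at h
  exact (sub_eq_zero.1 h.symm)

/-- The graded Betti numbers can be read off from any one minimal graded free resolution. -/
theorem hasBettiNumber_of_resolution {σ K M : Type*} [Field K]
    [AddCommMonoid M] {w : σ → M} {I : Ideal (MvPolynomial σ K)}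
    (F : MinimalGradedFreeResolution w I) (a : ℕ) (m : M) :
    HasBettiNumber w I a m (F.numGens a m) :=
  ⟨⟨F⟩, fun G => (G.numGens_le F a m).antisymm (F.numGens_le G a m)⟩

/-! ### Squarefree Veronese ideals -/

/-- The squarefree Veronese ideal on a set `T` of variables: it is generated by the products of
`j` distinct variables from `T`. -/
noncomputable def squarefreeVeronese (K : Type*) [Field K] {n : ℕ} (T : Finset (Fin n)) (j : ℕ) :
    Ideal (MvPolynomial (Fin n) K) :=
  Ideal.span {p | ∃ s : Finset (Fin n), s ⊆ T ∧ s.card = j ∧ p = ∏ t ∈ s, X t}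

theorem squarefreeVeronese_univ (K : Type*) [Field K] (n j : ℕ) :
    squarefreeVeronese K (Finset.univ : Finset (Fin n)) j = kOutOfNIdeal K n j := by
  simp [squarefreeVeronese, kOutOfNIdeal]

theorem squarefreeDegree_apply {n : ℕ} (s : Finset (Fin n)) (t : Fin n) :
    squarefreeDegree s t = if t ∈ s then 1 else 0 := by
  simp [squarefreeDegree, Finsupp.finsetSum_apply, Finsupp.single_apply]

theorem squarefreeDegree_injective {n : ℕ} :
    Function.Injective (squarefreeDegree : Finset (Fin n) → Fin n →₀ ℕ) := by
  intro s s' h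
  ext t
  have h1 := DFunLike.congr_fun h t
  rw [squarefreeDegree_apply, squarefreeDegree_apply] at h1
  by_cases h2 : t ∈ s <;> by_cases h3 : t ∈ s' <;> simp_all

theorem squarefreeDegree_insert {n : ℕ} {s : Finset (Fin n)} {t : Fin n} (ht : t ∉ s) :
    squarefreeDegree (insert t s) = squarefreeDegree s + Finsupp.single t 1 := by
  rw [squarefreeDegree, Finset.sum_insert ht, add_comm, squarefreeDegree]

theorem degree_squarefreeDegree {n : ℕ} (s : Finset (Fin n)) :
    (squarefreeDegree s).degree = s.card := by
  simp [squarefreeDegree, map_sum]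

theorem prod_X_eq_monomial {K : Type*} [Field K] {n : ℕ} (s : Finset (Fin n)) :
    (∏ t ∈ s, X t : MvPolynomial (Fin n) K) = monomial (squarefreeDegree s) 1 := by
  rw [squarefreeDegree, monomial_sum_one]
  rfl

theorem squarefreeDegree_le_iff {n : ℕ} {s : Finset (Fin n)} {e : Fin n →₀ ℕ} :
    squarefreeDegree s ≤ e ↔ s ⊆ e.support := by
  constructor
  · intro h t ht
    have := h t
    rw [squarefreeDegree_apply, if_pos ht] at this
    exact Finsupp.mem_support_iff.2 (by omega)
  · intro h t
    rw [squarefreeDegree_apply]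
    split_ifs with ht
    · exact Nat.one_le_iff_ne_zero.2 (Finsupp.mem_support_iff.1 (h ht))
    · exact Nat.zero_le _

/-- A polynomial lies in the squarefree Veronese ideal if and only if each of its monomials
involves at least `j` variables from `T`. -/
theorem mem_squarefreeVeronese {K : Type*} [Field K] {n : ℕ} {T : Finset (Fin n)} {j : ℕ}
    {p : MvPolynomial (Fin n) K} :
    p ∈ squarefreeVeronese K T j ↔ ∀ e, coeff e p ≠ 0 → j ≤ (T ∩ e.support).card := by
  have h : squarefreeVeronese K T j = Ideal.span ((fun e => monomial e (1 : K)) ''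
      {e | ∃ s : Finset (Fin n), s ⊆ T ∧ s.card = j ∧ e = squarefreeDegree s}) := by
    rw [squarefreeVeronese]
    congr 1
    ext p
    simp only [prod_X_eq_monomial, Set.mem_ofPred_eq, Set.mem_image]
    constructor
    · rintro ⟨s, hs, hc, rfl⟩
      exact ⟨_, ⟨s, hs, hc, rfl⟩, rfl⟩
    · rintro ⟨_, ⟨s, hs, hc, rfl⟩, rfl⟩
      exact ⟨s, hs, hc, rfl⟩
  rw [h, mem_ideal_span_monomial_image]
  refine forall_congr' fun e => ?_
  rw [mem_support_iff]
  refine imp_congr_right fun _ => ⟨?_, fun hj => ?_⟩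
  · rintro ⟨_, ⟨s, hs, rfl, rfl⟩, hle⟩
    exact Finset.card_le_card (Finset.subset_inter hs (squarefreeDegree_le_iff.1 hle))
  · obtain ⟨s, hs, hc⟩ := Finset.exists_subset_card_eq hj
    exact ⟨_, ⟨s, hs.trans Finset.inter_subset_left, hc, rfl⟩,
      squarefreeDegree_le_iff.2 (hs.trans Finset.inter_subset_right)⟩

theorem squarefreeVeronese_zero (K : Type*) [Field K] {n : ℕ} (T : Finset (Fin n)) :
    squarefreeVeronese K T 0 = ⊤ :=
  eq_top_iff.2 fun _ _ => mem_squarefreeVeronese.2 fun _ _ => Nat.zero_le _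

theorem squarefreeVeronese_empty_succ (K : Type*) [Field K] (n j : ℕ) :
    squarefreeVeronese K (∅ : Finset (Fin n)) (j + 1) = ⊥ := by
  refine eq_bot_iff.2 fun p hp => ?_
  rw [mem_squarefreeVeronese] at hp
  refine (Submodule.mem_bot _).2 (MvPolynomial.ext _ _ fun e => ?_)
  by_contra h
  simpa using hp e h

theorem squarefreeVeronese_succ_le (K : Type*) [Field K] {n : ℕ} (T : Finset (Fin n)) (j : ℕ) :
    squarefreeVeronese K T (j + 1) ≤ squarefreeVeronese K T j := fun _ hp =>
  mem_squarefreeVeronese.2 fun e he => (Nat.le_succ j).trans (mem_squarefreeVeronese.1 hp e he)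

theorem mem_squarefreeVeronese_of_X_mul_mem {K : Type*} [Field K] {n : ℕ} {T : Finset (Fin n)}
    {j : ℕ} {t : Fin n} (ht : t ∉ T) {p : MvPolynomial (Fin n) K}
    (hp : X t * p ∈ squarefreeVeronese K T j) : p ∈ squarefreeVeronese K T j := by
  rw [mem_squarefreeVeronese] at hp ⊢
  intro e he
  refine (hp (Finsupp.single t 1 + e) (by rwa [coeff_X_mul])).trans (Finset.card_le_card ?_)
  intro u hu
  rw [Finset.mem_inter, Finsupp.mem_support_iff] at hu ⊢
  refine ⟨hu.1, ?_⟩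
  have hut : t ≠ u := fun h => ht (h ▸ hu.1)
  simpa [Finsupp.single_apply, hut] using hu.2

theorem squarefreeVeronese_insert (K : Type*) [Field K] {n : ℕ} {T : Finset (Fin n)}
    {t : Fin n} (ht : t ∉ T) (j : ℕ) :
    squarefreeVeronese K (insert t T) (j + 1) =
      Ideal.span {X t} * squarefreeVeronese K T j ⊔ squarefreeVeronese K T (j + 1) := by
  apply le_antisymm
  · refine Ideal.span_le.2 ?_
    rintro _ ⟨s, hs, hc, rfl⟩
    by_cases hts : t ∈ s
    · rw [← Finset.mul_prod_erase s X hts]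
      refine Ideal.mem_sup_left (Ideal.mul_mem_mul (Ideal.mem_span_singleton_self _)
        (Ideal.subset_span ⟨s.erase t, ?_, ?_, rfl⟩))
      · exact (Finset.subset_insert_iff).1 hs
      · rw [Finset.card_erase_of_mem hts, hc, Nat.add_sub_cancel]
    · exact Ideal.mem_sup_right (Ideal.subset_span
        ⟨s, (Finset.subset_insert_iff_of_notMem hts).1 hs, hc, rfl⟩)
  · refine sup_le ?_ (Ideal.span_mono ?_)
    · refine Ideal.mul_le.2 fun x hx y hy => ?_
      obtain ⟨z, rfl⟩ := Ideal.mem_span_singleton'.1 hx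
      rw [mul_assoc]
      refine Ideal.mul_mem_left _ _ (mem_squarefreeVeronese.2 fun e he => ?_)
      rw [mul_comm, coeff_mul_X'] at he
      split_ifs at he with hte
      · have h1 := mem_squarefreeVeronese.1 hy _ he
        have h2 : insert t (T ∩ (e - Finsupp.single t 1).support) ⊆ insert t T ∩ e.support := by
          intro u hu
          rw [Finset.mem_insert, Finset.mem_inter] at hu
          rw [Finset.mem_inter, Finset.mem_insert]
          rcases hu with rfl | ⟨hu1, hu2⟩
          · exact ⟨Or.inl rfl, hte⟩
          · refine ⟨Or.inr hu1, ?_⟩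
            rw [Finsupp.mem_support_iff] at hu2 ⊢
            intro h0
            simp [h0] at hu2
        have h3 := Finset.card_le_card h2
        rw [Finset.card_insert_of_notMem fun h => ht (Finset.mem_inter.1 h).1] at h3
        omega
      · exact absurd rfl he
    · rintro p ⟨s, hs, hc, rfl⟩
      exact ⟨s, hs.trans (Finset.subset_insert t T), hc, rfl⟩

/-! ### Graded free resolutions with arbitrary finite index types -/

/-- A minimal graded free resolution of the ideal `I` whose free modules have bases indexed by
arbitrary finite types. -/
structure IndexedResolution {σ K M : Type*} [Field K] [AddCommMonoid M] (w : σ → M)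
    (I : Ideal (MvPolynomial σ K)) where
  /-- the index types of the bases -/
  ι : ℕ → Type
  [fin : ∀ a, Fintype (ι a)]
  /-- the degrees of the basis elements -/
  deg : ∀ a, ι a → M
  /-- the augmentation onto `I` -/
  ε : (ι 0 → MvPolynomial σ K) →ₗ[MvPolynomial σ K] MvPolynomial σ K
  /-- the differentials -/
  d : ∀ a, (ι (a + 1) → MvPolynomial σ K) →ₗ[MvPolynomial σ K] (ι a → MvPolynomial σ K)
  range_ε : LinearMap.range ε = I
  exact_zero : LinearMap.ker ε = LinearMap.range (d 0)
  exact_succ : ∀ a, LinearMap.ker (d a) = LinearMap.range (d (a + 1))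
  isGradedMap_ε : IsGradedMap w (deg 0) (fun _ => 0) (augmentationMap ε)
  isGradedMap_d : ∀ a, IsGradedMap w (deg (a + 1)) (deg a) (d a)
  minimal : ∀ a v c, constantCoeff (d a v c) = 0

attribute [instance] IndexedResolution.fin

namespace IndexedResolution

theorem single_comp_equiv_mem {σ K M A B : Type*} [Field K] [AddCommMonoid M] [DecidableEq B]
    (w : σ → M) (δ : A → M) (e : A ≃ B) (b : B) :
    (Pi.single b 1 : B → MvPolynomial σ K) ∘ e ∈ homogeneousVectors w δ (δ (e.symm b)) := by
  intro c u h
  simpa using single_one_mem_homogeneousVectors w (fun b => δ (e.symm b)) b (e c) u h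

/-- Enumerating the index types turns an indexed resolution into one with the index types
`Fin r`. -/
noncomputable def toMinimalGradedFreeResolution {σ K M : Type*} [Field K] [AddCommMonoid M]
    {w : σ → M} {I : Ideal (MvPolynomial σ K)} (F : IndexedResolution w I) :
    MinimalGradedFreeResolution w I where
  rank a := Fintype.card (F.ι a)
  deg a b := F.deg a ((Fintype.equivFin (F.ι a)).symm b)
  ε := F.ε ∘ₗ (LinearEquiv.funCongrLeft (MvPolynomial σ K) (MvPolynomial σ K)
    (Fintype.equivFin (F.ι 0))).toLinearMap
  d a := (LinearEquiv.funCongrLeft (MvPolynomial σ K) (MvPolynomial σ K)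
      (Fintype.equivFin (F.ι a))).symm.toLinearMap ∘ₗ F.d a ∘ₗ
    (LinearEquiv.funCongrLeft (MvPolynomial σ K) (MvPolynomial σ K)
      (Fintype.equivFin (F.ι (a + 1)))).toLinearMap
  range_ε := by
    rw [LinearEquiv.range_comp, F.range_ε]
  exact_zero := by
    rw [LinearMap.ker_comp, F.exact_zero, ← LinearMap.comp_assoc, LinearEquiv.range_comp,
      LinearMap.range_comp]
    exact Submodule.comap_equiv_eq_map_symm _ _
  exact_succ a := by
    rw [LinearEquiv.ker_comp, LinearMap.ker_comp, F.exact_succ, ← LinearMap.comp_assoc,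
      LinearEquiv.range_comp, LinearMap.range_comp]
    exact Submodule.comap_equiv_eq_map_symm _ _
  homogeneous_ε b e h := by
    have h1 := F.isGradedMap_ε _ _
      (single_comp_equiv_mem (K := K) w (F.deg 0) (Fintype.equivFin (F.ι 0)) b) () e h
    rwa [add_zero] at h1
  homogeneous_d a b c e h :=
    F.isGradedMap_d a _ _ (single_comp_equiv_mem w (F.deg (a + 1))
      (Fintype.equivFin (F.ι (a + 1))) b) ((Fintype.equivFin (F.ι a)).symm c) e h
  minimal a v c := F.minimal a _ _

theorem numGens_toMinimalGradedFreeResolution {σ K M : Type*} [Field K] [AddCommMonoid M]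
    {w : σ → M} {I : Ideal (MvPolynomial σ K)} (F : IndexedResolution w I) (a : ℕ) (m : M) :
    F.toMinimalGradedFreeResolution.numGens a m = Nat.card {b : F.ι a // F.deg a b = m} :=
  Nat.card_congr ((Fintype.equivFin (F.ι a)).symm.subtypeEquiv fun _ => Iff.rfl)

/-- The inclusion of an ideal into another one lifts to a graded chain map between resolutions. -/
theorem exists_chainMap {σ K M : Type*} [Field K] [AddCommMonoid M] {w : σ → M}
    {I J : Ideal (MvPolynomial σ K)} (F : IndexedResolution w I) (G : IndexedResolution w J)
    (hIJ : I ≤ J) :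
    ∃ φ : ∀ a, (F.ι a → MvPolynomial σ K) →ₗ[MvPolynomial σ K] (G.ι a → MvPolynomial σ K),
      (∀ a, IsGradedMap w (F.deg a) (G.deg a) (φ a)) ∧ (∀ v, G.ε (φ 0 v) = F.ε v) ∧
      ∀ a v, G.d a (φ (a + 1) v) = φ a (F.d a v) := by
  classical
  have h0 : ∃ f : (F.ι 0 → MvPolynomial σ K) →ₗ[MvPolynomial σ K] (G.ι 0 → MvPolynomial σ K),
      (IsGradedMap w (F.deg 0) (G.deg 0) f ∧
        LinearMap.range (f ∘ₗ F.d 0) ≤ LinearMap.range (G.d 0)) ∧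
      ∀ v, G.ε (f v) = F.ε v := by
    obtain ⟨f, hf, hf'⟩ := F.isGradedMap_ε.exists_lift G.isGradedMap_ε
      (range_augmentationMap_le (by rw [F.range_ε, G.range_ε]; exact hIJ))
    have h1 : ∀ v, G.ε (f v) = F.ε v := fun v => congrFun (LinearMap.congr_fun hf' v) ()
    refine ⟨f, ⟨hf, ?_⟩, h1⟩
    rw [← G.exact_zero]
    rintro _ ⟨v, rfl⟩
    have : F.ε (F.d 0 v) = 0 :=
      LinearMap.mem_ker.1 (F.exact_zero ▸ LinearMap.mem_range_self (F.d 0) v)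
    simp [h1, this]
  have hs : ∀ (a : ℕ) (f : {f : (F.ι a → MvPolynomial σ K) →ₗ[MvPolynomial σ K]
        (G.ι a → MvPolynomial σ K) // IsGradedMap w (F.deg a) (G.deg a) f ∧
        LinearMap.range (f ∘ₗ F.d a) ≤ LinearMap.range (G.d a)}),
      ∃ g : {g : (F.ι (a + 1) → MvPolynomial σ K) →ₗ[MvPolynomial σ K]
        (G.ι (a + 1) → MvPolynomial σ K) // IsGradedMap w (F.deg (a + 1)) (G.deg (a + 1)) g ∧
        LinearMap.range (g ∘ₗ F.d (a + 1)) ≤ LinearMap.range (G.d (a + 1))},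
      ∀ v, G.d a (g.1 v) = f.1 (F.d a v) := by
    rintro a ⟨f, hf, hr⟩
    obtain ⟨g, hg, hg'⟩ := (hf.comp (F.isGradedMap_d a)).exists_lift (G.isGradedMap_d a) hr
    have h1 : ∀ v, G.d a (g v) = f (F.d a v) := LinearMap.congr_fun hg'
    refine ⟨⟨g, hg, ?_⟩, h1⟩
    rw [← G.exact_succ]
    rintro _ ⟨v, rfl⟩
    have : F.d a (F.d (a + 1) v) = 0 :=
      LinearMap.mem_ker.1 (F.exact_succ a ▸ LinearMap.mem_range_self (F.d (a + 1)) v)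
    simp [h1, this]
  obtain ⟨f₀, hf₀, hε⟩ := h0
  choose next hnext using hs
  let φ : ∀ a, {f : (F.ι a → MvPolynomial σ K) →ₗ[MvPolynomial σ K]
        (G.ι a → MvPolynomial σ K) // IsGradedMap w (F.deg a) (G.deg a) f ∧
        LinearMap.range (f ∘ₗ F.d a) ≤ LinearMap.range (G.d a)} :=
    fun a => Nat.rec ⟨f₀, hf₀⟩ (fun a f => next a f) a
  exact ⟨fun a => (φ a).1, fun a => (φ a).2.1, hε, fun a => hnext a (φ a)⟩

/-- The resolution of the zero ideal by zero modules. -/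
noncomputable def bot {σ K M : Type*} [Field K] [AddCommMonoid M] (w : σ → M) :
    IndexedResolution w (⊥ : Ideal (MvPolynomial σ K)) where
  ι _ := Empty
  deg _ := Empty.elim
  ε := 0
  d _ := 0
  range_ε := LinearMap.range_zero
  exact_zero := Subsingleton.elim _ _
  exact_succ _ := Subsingleton.elim _ _
  isGradedMap_ε := isGradedMap_iff.2 fun b => b.elim
  isGradedMap_d _ := isGradedMap_iff.2 fun b => b.elim
  minimal _ _ c := c.elim

/-- The index types of the trivial resolution of the unit ideal: one basis element in homological
degree zero. -/
def topIndex : ℕ → Type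
  | 0 => Unit
  | _ + 1 => Empty

instance (a : ℕ) : Fintype (topIndex a) :=
  match a with
  | 0 => inferInstanceAs (Fintype Unit)
  | _ + 1 => inferInstanceAs (Fintype Empty)

instance (a : ℕ) : IsEmpty (topIndex (a + 1)) := inferInstanceAs (IsEmpty Empty)

/-- The trivial resolution of the unit ideal. -/
noncomputable def top {σ K M : Type*} [Field K] [AddCommMonoid M] (w : σ → M) :
    IndexedResolution w (⊤ : Ideal (MvPolynomial σ K)) where
  ι := topIndex
  deg _ _ := 0
  ε := LinearMap.proj (() : Unit)
  d _ := 0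
  range_ε := LinearMap.range_eq_top.2 fun p => ⟨fun _ => p, rfl⟩
  exact_zero := by
    rw [LinearMap.range_zero]
    exact LinearMap.ker_eq_bot.2 fun u v h => funext fun _ => h
  exact_succ _ := Subsingleton.elim _ _
  isGradedMap_ε := fun _ _ hv c e h => hv c e h
  isGradedMap_d _ := by
    classical
    exact isGradedMap_iff.2 fun b => isEmptyElim b
  minimal _ _ _ := by simp

end IndexedResolution

/-! ### The mapping cone -/

namespace IndexedResolution

/-- The index types of a family, moved up by one homological degree. -/
def prevIndex (ι : ℕ → Type) : ℕ → Type
  | 0 => Empty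
  | a + 1 => ι a

instance {ι : ℕ → Type} [∀ a, Fintype (ι a)] (a : ℕ) : Fintype (prevIndex ι a) :=
  match a with
  | 0 => inferInstanceAs (Fintype Empty)
  | a + 1 => inferInstanceAs (Fintype (ι a))

instance {ι : ℕ → Type} : IsEmpty (prevIndex ι 0) := inferInstanceAs (IsEmpty Empty)

/-- The degrees of the basis elements, moved up by one homological degree. -/
def prevDeg {M : Type*} {ι : ℕ → Type} (deg : ∀ a, ι a → M) : ∀ a, prevIndex ι a → M
  | 0 => Empty.elim
  | a + 1 => deg a

/-- The differentials of the resolution moved up by one homological degree. -/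
noncomputable def prevD {σ K M : Type*} [Field K] [AddCommMonoid M] {w : σ → M}
    {I : Ideal (MvPolynomial σ K)} (F : IndexedResolution w I) :
    ∀ a, (F.ι a → MvPolynomial σ K) →ₗ[MvPolynomial σ K] (prevIndex F.ι a → MvPolynomial σ K)
  | 0 => 0
  | a + 1 => F.d a

theorem d_d {σ K M : Type*} [Field K] [AddCommMonoid M] {w : σ → M}
    {I : Ideal (MvPolynomial σ K)} (F : IndexedResolution w I) (a : ℕ)
    (v : F.ι (a + 2) → MvPolynomial σ K) : F.d a (F.d (a + 1) v) = 0 :=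
  LinearMap.mem_ker.1 (F.exact_succ a ▸ LinearMap.mem_range_self (F.d (a + 1)) v)

theorem ε_d {σ K M : Type*} [Field K] [AddCommMonoid M] {w : σ → M}
    {I : Ideal (MvPolynomial σ K)} (F : IndexedResolution w I)
    (v : F.ι 1 → MvPolynomial σ K) : F.ε (F.d 0 v) = 0 :=
  LinearMap.mem_ker.1 (F.exact_zero ▸ LinearMap.mem_range_self (F.d 0) v)

theorem exists_d_eq {σ K M : Type*} [Field K] [AddCommMonoid M] {w : σ → M}
    {I : Ideal (MvPolynomial σ K)} (F : IndexedResolution w I) {a : ℕ}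
    {v : F.ι (a + 1) → MvPolynomial σ K} (hv : F.d a v = 0) : ∃ u, F.d (a + 1) u = v := by
  have h : v ∈ LinearMap.ker (F.d a) := hv
  rwa [F.exact_succ] at h

theorem exists_d_zero_eq {σ K M : Type*} [Field K] [AddCommMonoid M] {w : σ → M}
    {I : Ideal (MvPolynomial σ K)} (F : IndexedResolution w I)
    {v : F.ι 0 → MvPolynomial σ K} (hv : F.ε v = 0) : ∃ u, F.d 0 u = v := by
  have h : v ∈ LinearMap.ker F.ε := hv
  rwa [F.exact_zero] at h

theorem prevD_d {σ K M : Type*} [Field K] [AddCommMonoid M] {w : σ → M}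
    {I : Ideal (MvPolynomial σ K)} (F : IndexedResolution w I) (a : ℕ)
    (v : F.ι (a + 1) → MvPolynomial σ K) : F.prevD a (F.d a v) = 0 := by
  cases a with
  | zero => rfl
  | succ a => exact F.d_d a v

theorem ε_mem {σ K M : Type*} [Field K] [AddCommMonoid M] {w : σ → M}
    {I : Ideal (MvPolynomial σ K)} (F : IndexedResolution w I)
    (v : F.ι 0 → MvPolynomial σ K) : F.ε v ∈ I :=
  F.range_ε.le (LinearMap.mem_range_self F.ε v)

theorem exists_ε_eq {σ K M : Type*} [Field K] [AddCommMonoid M] {w : σ → M}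
    {I : Ideal (MvPolynomial σ K)} (F : IndexedResolution w I) {p : MvPolynomial σ K}
    (hp : p ∈ I) : ∃ u, F.ε u = p :=
  F.range_ε.ge hp

/-- The augmentation of the mapping cone. -/
noncomputable def coneε {σ K M : Type*} [Field K] [AddCommMonoid M] {w : σ → M}
    {I J : Ideal (MvPolynomial σ K)} (F : IndexedResolution w I) (G : IndexedResolution w J)
    (t : σ) :
    (((G.ι 0 ⊕ F.ι 0) ⊕ prevIndex F.ι 0) → MvPolynomial σ K) →ₗ[MvPolynomial σ K]
      MvPolynomial σ K :=
  (X t : MvPolynomial σ K) • (G.ε ∘ₗ LinearMap.funLeft _ _ fun c => Sum.inl (Sum.inl c)) +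
    F.ε ∘ₗ LinearMap.funLeft _ _ fun c => Sum.inl (Sum.inr c)

/-- The differentials of the mapping cone of `φ : F → G` and of the multiplication by `X t` on
`F`: it maps `(g, f, f')` to `(d g + φ f', d f - X t • f', - d f')`. -/
noncomputable def coneD {σ K M : Type*} [Field K] [AddCommMonoid M] {w : σ → M}
    {I J : Ideal (MvPolynomial σ K)} (F : IndexedResolution w I) (G : IndexedResolution w J)
    (φ : ∀ a, (F.ι a → MvPolynomial σ K) →ₗ[MvPolynomial σ K] (G.ι a → MvPolynomial σ K))
    (t : σ) (a : ℕ) :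
    (((G.ι (a + 1) ⊕ F.ι (a + 1)) ⊕ prevIndex F.ι (a + 1)) → MvPolynomial σ K)
      →ₗ[MvPolynomial σ K] (((G.ι a ⊕ F.ι a) ⊕ prevIndex F.ι a) → MvPolynomial σ K) :=
  LinearMap.pi (Sum.elim (Sum.elim
    (fun c => LinearMap.proj c ∘ₗ
      (G.d a ∘ₗ LinearMap.funLeft _ _ (fun c => Sum.inl (Sum.inl c)) +
        φ a ∘ₗ LinearMap.funLeft _ _ (fun c : F.ι a => Sum.inr c)))
    (fun c => LinearMap.proj c ∘ₗ
      (F.d a ∘ₗ LinearMap.funLeft _ _ (fun c => Sum.inl (Sum.inr c)) -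
        (X t : MvPolynomial σ K) • LinearMap.funLeft _ _ (fun c : F.ι a => Sum.inr c))))
    (fun c => LinearMap.proj c ∘ₗ
      (-(F.prevD a ∘ₗ LinearMap.funLeft _ _ (fun c : F.ι a => Sum.inr c)))))

theorem coneD_elim {σ K M : Type*} [Field K] [AddCommMonoid M] {w : σ → M}
    {I J : Ideal (MvPolynomial σ K)} (F : IndexedResolution w I) (G : IndexedResolution w J)
    (φ : ∀ a, (F.ι a → MvPolynomial σ K) →ₗ[MvPolynomial σ K] (G.ι a → MvPolynomial σ K))
    (t : σ) (a : ℕ) (g : G.ι (a + 1) → MvPolynomial σ K) (f : F.ι (a + 1) → MvPolynomial σ K)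
    (f' : F.ι a → MvPolynomial σ K) :
    coneD F G φ t a (Sum.elim (Sum.elim g f) f') =
      Sum.elim (Sum.elim (G.d a g + φ a f') (F.d a f - (X t : MvPolynomial σ K) • f'))
        (-(F.prevD a f')) := by
  funext c
  rcases c with (c | c) | c <;> rfl

theorem range_coneε {σ K M : Type*} [Field K] [AddCommMonoid M] {w : σ → M}
    {I J : Ideal (MvPolynomial σ K)} (F : IndexedResolution w I) (G : IndexedResolution w J)
    (t : σ) : LinearMap.range (coneε F G t) = Ideal.span {X t} * J ⊔ I := by
  ext p
  rw [Submodule.mem_sup]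
  constructor
  · rintro ⟨v, rfl⟩
    exact ⟨_, Ideal.mul_mem_mul (Ideal.mem_span_singleton_self _) (G.ε_mem _), _, F.ε_mem _, rfl⟩
  · rintro ⟨y, hy, z, hz, rfl⟩
    obtain ⟨q, hq, rfl⟩ := Ideal.mem_span_singleton_mul.1 hy
    obtain ⟨g, rfl⟩ := G.exists_ε_eq hq
    obtain ⟨f, rfl⟩ := F.exists_ε_eq hz
    exact ⟨Sum.elim (Sum.elim g f) isEmptyElim, rfl⟩

theorem ker_coneε {σ K M : Type*} [Field K] [AddCommMonoid M] {w : σ → M}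
    {I J : Ideal (MvPolynomial σ K)} (F : IndexedResolution w I) (G : IndexedResolution w J)
    (φ : ∀ a, (F.ι a → MvPolynomial σ K) →ₗ[MvPolynomial σ K] (G.ι a → MvPolynomial σ K))
    (hφε : ∀ v, G.ε (φ 0 v) = F.ε v) (t : σ) (ht : ∀ p, X t * p ∈ I → p ∈ I) :
    LinearMap.ker (coneε F G t) = LinearMap.range (coneD F G φ t 0) := by
  ext v
  constructor
  · intro hv
    have hv' : X t * G.ε (fun c => v (Sum.inl (Sum.inl c))) +
      F.ε (fun c => v (Sum.inl (Sum.inr c))) = 0 := hv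
    have hmem : G.ε (fun c => v (Sum.inl (Sum.inl c))) ∈ I := by
      refine ht _ ?_
      rw [eq_neg_of_add_eq_zero_left hv', ← map_neg]
      exact F.ε_mem _
    obtain ⟨u, hu⟩ := F.exists_ε_eq hmem
    obtain ⟨p, hp⟩ := F.exists_d_zero_eq
      (v := (fun c => v (Sum.inl (Sum.inr c))) + (X t : MvPolynomial σ K) • u) (by
        rw [map_add, map_smul, hu, smul_eq_mul, add_comm, hv'])
    obtain ⟨q, hq⟩ := G.exists_d_zero_eq (v := (fun c => v (Sum.inl (Sum.inl c))) - φ 0 u) (by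
        rw [map_sub, hφε, hu, sub_self])
    refine ⟨Sum.elim (Sum.elim q p) u, ?_⟩
    rw [coneD_elim, hp, hq, sub_add_cancel, add_sub_cancel_right]
    funext c
    rcases c with (c | c) | c
    · rfl
    · rfl
    · exact isEmptyElim c
  · rintro ⟨v, rfl⟩
    change X t * G.ε (G.d 0 (fun c => v (Sum.inl (Sum.inl c))) + φ 0 (fun c => v (Sum.inr c))) +
      F.ε (F.d 0 (fun c => v (Sum.inl (Sum.inr c))) -
        (X t : MvPolynomial σ K) • (fun c : F.ι 0 => v (Sum.inr c))) = 0
    rw [map_add, map_sub, map_smul, G.ε_d, F.ε_d, hφε, smul_eq_mul]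
    ring

theorem ker_coneD {σ K M : Type*} [Field K] [AddCommMonoid M] {w : σ → M}
    {I J : Ideal (MvPolynomial σ K)} (F : IndexedResolution w I) (G : IndexedResolution w J)
    (φ : ∀ a, (F.ι a → MvPolynomial σ K) →ₗ[MvPolynomial σ K] (G.ι a → MvPolynomial σ K))
    (hφd : ∀ a v, G.d a (φ (a + 1) v) = φ a (F.d a v)) (t : σ) (a : ℕ) :
    LinearMap.ker (coneD F G φ t a) = LinearMap.range (coneD F G φ t (a + 1)) := by
  ext v
  constructor
  · intro hv
    set g : G.ι (a + 1) → MvPolynomial σ K := fun c => v (Sum.inl (Sum.inl c))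
    set f : F.ι (a + 1) → MvPolynomial σ K := fun c => v (Sum.inl (Sum.inr c))
    set f' : F.ι a → MvPolynomial σ K := fun c => v (Sum.inr c)
    have h1 : G.d a g + φ a f' = 0 :=
      funext fun c => congrFun (LinearMap.mem_ker.1 hv) (Sum.inl (Sum.inl c))
    have h2 : F.d a f - (X t : MvPolynomial σ K) • f' = 0 :=
      funext fun c => congrFun (LinearMap.mem_ker.1 hv) (Sum.inl (Sum.inr c))
    have h3 : -(F.prevD a f') = 0 :=
      funext fun c => congrFun (LinearMap.mem_ker.1 hv) (Sum.inr c)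
    have h4 : ∃ u, F.d a u = f' := by
      cases a with
      | zero =>
        -- here `prevD` says nothing, but `X t • f'` is a boundary and `X t` is no zero divisor
        refine F.exists_d_zero_eq ?_
        have h5 := F.ε_d f
        rw [sub_eq_zero.1 h2, map_smul, smul_eq_mul] at h5
        exact (mul_eq_zero.1 h5).resolve_left (X_ne_zero t)
      | succ a => exact F.exists_d_eq (neg_eq_zero.1 h3)
    obtain ⟨u, hu⟩ := h4
    obtain ⟨p, hp⟩ := F.exists_d_eq (v := f - (X t : MvPolynomial σ K) • u) (by
      rw [map_sub, map_smul, hu, h2])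
    obtain ⟨q, hq⟩ := G.exists_d_eq (v := g + φ (a + 1) u) (by
      rw [map_add, hφd, hu, h1])
    refine ⟨Sum.elim (Sum.elim q p) (-u), ?_⟩
    rw [coneD_elim, hp, hq, map_neg, add_neg_cancel_right, smul_neg, sub_neg_eq_add,
      sub_add_cancel, map_neg, neg_neg]
    funext c
    rcases c with (c | c) | c
    · rfl
    · rfl
    · exact congrFun hu c
  · rintro ⟨v, rfl⟩
    have h : v = Sum.elim (Sum.elim (fun c => v (Sum.inl (Sum.inl c)))
        (fun c => v (Sum.inl (Sum.inr c)))) (fun c : F.ι (a + 1) => v (Sum.inr c)) := by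
      funext c
      rcases c with (c | c) | c <;> rfl
    generalize (fun c => v (Sum.inl (Sum.inl c))) = g at h
    generalize (fun c => v (Sum.inl (Sum.inr c))) = f at h
    generalize (fun c : F.ι (a + 1) => v (Sum.inr c)) = f' at h
    refine LinearMap.mem_ker.2 (((congrArg (coneD F G φ t a)
      ((congrArg (coneD F G φ t (a + 1)) h).trans (coneD_elim F G φ t (a + 1) g f f'))).trans
        (coneD_elim F G φ t a _ _ (-(F.d a f')))).trans ?_)
    rw [map_add, map_sub, map_neg, map_neg, map_smul, hφd, G.d_d, F.d_d, F.prevD_d]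
    funext c
    rcases c with (c | c) | c <;> simp

theorem constantCoeff_prevD {σ K M : Type*} [Field K] [AddCommMonoid M] {w : σ → M}
    {I : Ideal (MvPolynomial σ K)} (F : IndexedResolution w I) (a : ℕ)
    (v : F.ι a → MvPolynomial σ K) (c : prevIndex F.ι a) : constantCoeff (F.prevD a v c) = 0 := by
  cases a with
  | zero => exact isEmptyElim c
  | succ a => exact F.minimal a v c

theorem isGradedMap_prevD {σ K M : Type*} [Field K] [AddCommMonoid M] {w : σ → M}
    {I : Ideal (MvPolynomial σ K)} (F : IndexedResolution w I) (a : ℕ) :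
    IsGradedMap w (F.deg a) (prevDeg F.deg a) (F.prevD a) := by
  cases a with
  | zero => exact fun m v hv c => isEmptyElim c
  | succ a => exact F.isGradedMap_d a

/-- The degrees of the basis elements of the mapping cone. -/
def coneDeg {σ K M : Type*} [Field K] [AddCommMonoid M] {w : σ → M}
    {I J : Ideal (MvPolynomial σ K)} (F : IndexedResolution w I) (G : IndexedResolution w J)
    (t : σ) (a : ℕ) : ((G.ι a ⊕ F.ι a) ⊕ prevIndex F.ι a) → M :=
  Sum.elim (Sum.elim (fun c => G.deg a c + w t) (F.deg a)) (fun c => prevDeg F.deg a c + w t)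

theorem X_smul_mem_homogeneousVectors {σ K M A : Type*} [Field K] [AddCommMonoid M] {w : σ → M}
    {δ : A → M} {m : M} (t : σ) {v : A → MvPolynomial σ K}
    (hv : v ∈ homogeneousVectors w (fun c => δ c + w t) m) :
    (X t : MvPolynomial σ K) • v ∈ homogeneousVectors w δ m := by
  classical
  intro c e h
  rw [Pi.smul_apply, smul_eq_mul, mul_comm, coeff_mul_X'] at h
  split_ifs at h with hte
  · rw [← hv c _ h]
    have h1 : e = (e - Finsupp.single t 1) + Finsupp.single t 1 :=
      (tsub_add_cancel_of_le (Finsupp.single_le_iff.2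
        (Nat.one_le_iff_ne_zero.2 (Finsupp.mem_support_iff.1 hte)))).symm
    conv_lhs => rw [h1]
    rw [map_add, Finsupp.weight_single, one_smul, add_assoc, add_comm (w t)]
  · exact absurd rfl h

/-- Let `F` and `G` resolve the ideals `I ≤ J`, where `X t` is a nonzerodivisor modulo `I`, and
let `φ : F → G` be a comparison map without constant terms. As the intersection of `X t • J` and
`I` is `X t • I`, the mapping cone of the map from `F` to the sum of `G` and `F` given by `φ` and
by the multiplication with `X t` is a minimal resolution of `X t • J + I`. -/
noncomputable def cone {σ K M : Type*} [Field K] [AddCommMonoid M] {w : σ → M}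
    {I J : Ideal (MvPolynomial σ K)} (F : IndexedResolution w I) (G : IndexedResolution w J)
    (φ : ∀ a, (F.ι a → MvPolynomial σ K) →ₗ[MvPolynomial σ K] (G.ι a → MvPolynomial σ K))
    (hφ : ∀ a, IsGradedMap w (F.deg a) (G.deg a) (φ a)) (hφε : ∀ v, G.ε (φ 0 v) = F.ε v)
    (hφd : ∀ a v, G.d a (φ (a + 1) v) = φ a (F.d a v))
    (hφ0 : ∀ a v c, constantCoeff (φ a v c) = 0)
    (t : σ) (ht : ∀ p, X t * p ∈ I → p ∈ I) :
    IndexedResolution w (Ideal.span {X t} * J ⊔ I) where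
  ι a := (G.ι a ⊕ F.ι a) ⊕ prevIndex F.ι a
  deg := coneDeg F G t
  ε := coneε F G t
  d := coneD F G φ t
  range_ε := range_coneε F G t
  exact_zero := ker_coneε F G φ hφε t ht
  exact_succ := ker_coneD F G φ hφd t
  isGradedMap_ε m v hv := by
    have hg : (fun c => v (Sum.inl (Sum.inl c))) ∈
        homogeneousVectors w (fun c => G.deg 0 c + w t) m := fun c => hv (Sum.inl (Sum.inl c))
    have hf : (fun c => v (Sum.inl (Sum.inr c))) ∈ homogeneousVectors w (F.deg 0) m :=
      fun c => hv (Sum.inl (Sum.inr c))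
    exact add_mem (X_smul_mem_homogeneousVectors t (G.isGradedMap_ε.shift (w t) m _ hg))
      (F.isGradedMap_ε m _ hf)
  isGradedMap_d a m v hv := by
    have hg : (fun c => v (Sum.inl (Sum.inl c))) ∈
        homogeneousVectors w (fun c => G.deg (a + 1) c + w t) m :=
      fun c => hv (Sum.inl (Sum.inl c))
    have hf : (fun c => v (Sum.inl (Sum.inr c))) ∈ homogeneousVectors w (F.deg (a + 1)) m :=
      fun c => hv (Sum.inl (Sum.inr c))
    have hf' : (fun c => v (Sum.inr c)) ∈ homogeneousVectors w (fun c => F.deg a c + w t) m :=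
      fun c => hv (Sum.inr c)
    rintro ((c | c) | c)
    · exact add_mem ((G.isGradedMap_d a).shift (w t) m _ hg) ((hφ a).shift (w t) m _ hf') c
    · exact sub_mem (F.isGradedMap_d a m _ hf) (X_smul_mem_homogeneousVectors t hf') c
    · exact neg_mem ((F.isGradedMap_prevD a).shift (w t) m _ hf') c
  minimal a v c := by
    rcases c with (c | c) | c
    · change constantCoeff (G.d a _ c + φ a _ c) = 0
      rw [map_add, G.minimal, hφ0, add_zero]
    · change constantCoeff (F.d a _ c - X t * v (Sum.inr c)) = 0
      rw [map_sub, F.minimal, map_mul, constantCoeff_X, zero_mul, sub_zero]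
    · change constantCoeff (-(F.prevD a _ c)) = 0
      rw [map_neg, F.constantCoeff_prevD, neg_zero]

end IndexedResolution

/-! ### Resolutions of squarefree Veronese ideals -/

/-- A graded map has no constant terms if no basis element of its source has the same degree as a
basis element of its target. -/
theorem IsGradedMap.constantCoeff_eq_zero {σ K M A B : Type*} [Field K] [AddCommMonoid M]
    [Fintype A] {w : σ → M} {δA : A → M} {δB : B → M}
    {f : (A → MvPolynomial σ K) →ₗ[MvPolynomial σ K] (B → MvPolynomial σ K)}
    (hf : IsGradedMap w δA δB f) (h : ∀ a b, δB b ≠ δA a) (v : A → MvPolynomial σ K) (c : B) :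
    constantCoeff (f v c) = 0 := by
  classical
  rw [apply_eq_sum_single, map_sum]
  refine Finset.sum_eq_zero fun a _ => ?_
  rw [map_mul]
  refine mul_eq_zero_of_right _ ?_
  by_contra hne
  have h1 := isGradedMap_iff.1 hf a c 0 hne
  rw [map_zero, zero_add] at h1
  exact h a c h1

theorem natCard_coneDeg {σ K M : Type*} [Field K] [AddCommMonoid M] {w : σ → M}
    {I J : Ideal (MvPolynomial σ K)} (F : IndexedResolution w I) (G : IndexedResolution w J)
    (t : σ) (a : ℕ) (m : M) :
    Nat.card {b // IndexedResolution.coneDeg F G t a b = m} =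
      Nat.card {b // G.deg a b + w t = m} + Nat.card {b // F.deg a b = m} +
        Nat.card {b // IndexedResolution.prevDeg F.deg a b + w t = m} := by
  classical
  have h1 : Nat.card {b // IndexedResolution.coneDeg F G t a b = m} =
      Nat.card ({b // Sum.elim (fun c => G.deg a c + w t) (F.deg a) b = m} ⊕
        {b // IndexedResolution.prevDeg F.deg a b + w t = m}) :=
    Nat.card_congr Equiv.subtypeSum
  have h2 : Nat.card {b // Sum.elim (fun c => G.deg a c + w t) (F.deg a) b = m} =
      Nat.card ({b // G.deg a b + w t = m} ⊕ {b // F.deg a b = m}) :=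
    Nat.card_congr Equiv.subtypeSum
  rw [h1, Nat.card_sum, h2, Nat.card_sum]

theorem exists_resolution_squarefreeVeronese_zero (K : Type*) [Field K] {n : ℕ}
    (T : Finset (Fin n)) :
    ∃ F : IndexedResolution (multiWeight n) (squarefreeVeronese K T 0),
      (∀ a b, ∃ s ⊆ T, s.card = a + 0 ∧ F.deg a b = squarefreeDegree s) ∧
      ∀ a s, s ⊆ T → s.card = a + 0 →
        Nat.card {b // F.deg a b = squarefreeDegree s} = Nat.multichoose 0 a := by
  rw [squarefreeVeronese_zero]
  refine ⟨IndexedResolution.top _, fun a b => ?_, fun a s _ hc => ?_⟩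
  · cases a with
    | zero => exact ⟨∅, Finset.empty_subset T, rfl, rfl⟩
    | succ a => exact isEmptyElim (α := IndexedResolution.topIndex (a + 1)) b
  · cases a with
    | zero =>
      obtain rfl := Finset.card_eq_zero.1 hc
      have : Nat.card {b : Unit // (0 : Fin n →₀ ℕ) = squarefreeDegree ∅} = 1 := by
        rw [Nat.card_eq_one_iff_unique]
        exact ⟨inferInstance, ⟨⟨(), rfl⟩⟩⟩
      exact this.trans (Nat.multichoose_zero_right 0).symm
    | succ a =>
      have : IsEmpty {b : IndexedResolution.topIndex (a + 1) //
        (0 : Fin n →₀ ℕ) = squarefreeDegree s} := inferInstance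
      exact (Nat.card_eq_zero.2 (Or.inl this)).trans (Nat.multichoose_zero_succ a).symm

/-- The squarefree Veronese ideal has a multigraded minimal free resolution in which the basis
elements in homological degree `a` have the degrees of the sets of `a + j` variables of `T`, and
each such set occurs `Nat.multichoose j a` times. Adding a variable to `T` amounts to a mapping
cone, and to the recursion of `Nat.multichoose`. -/
theorem exists_resolution_squarefreeVeronese (K : Type*) [Field K] {n : ℕ} (T : Finset (Fin n))
    (j : ℕ) :
    ∃ F : IndexedResolution (multiWeight n) (squarefreeVeronese K T j),
      (∀ a b, ∃ s ⊆ T, s.card = a + j ∧ F.deg a b = squarefreeDegree s) ∧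
      ∀ a s, s ⊆ T → s.card = a + j →
        Nat.card {b // F.deg a b = squarefreeDegree s} = Nat.multichoose j a := by
  induction T using Finset.induction_on generalizing j with
  | empty =>
    cases j with
    | zero => exact exists_resolution_squarefreeVeronese_zero K ∅
    | succ j =>
      rw [squarefreeVeronese_empty_succ]
      refine ⟨IndexedResolution.bot _, fun a b => b.elim, fun a s hs hc => ?_⟩
      rw [Finset.subset_empty.1 hs, Finset.card_empty] at hc
      omega
  | insert t T ht ih =>
    cases j with
    | zero => exact exists_resolution_squarefreeVeronese_zero K (insert t T)
    | succ j =>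
      obtain ⟨F, hF, hFc⟩ := ih (j + 1)
      obtain ⟨G, hG, hGc⟩ := ih j
      obtain ⟨φ, hφ, hφε, hφd⟩ := F.exists_chainMap G (squarefreeVeronese_succ_le K T j)
      have hφ0 : ∀ a v c, constantCoeff (φ a v c) = 0 := fun a =>
        (hφ a).constantCoeff_eq_zero fun b c h => by
          obtain ⟨s, -, hs, hs'⟩ := hF a b
          obtain ⟨s', -, hs1, hs1'⟩ := hG a c
          rw [hs', hs1'] at h
          rw [squarefreeDegree_injective h] at hs1
          omega
      have hFt : ∀ a b, F.deg a b t = 0 := fun a b => by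
        obtain ⟨s, hs, -, h⟩ := hF a b
        rw [h, squarefreeDegree_apply, if_neg fun h => ht (hs h)]
      have hshift : ∀ {s : Finset (Fin n)} (α : Fin n →₀ ℕ), t ∈ s →
          (α + multiWeight n t = squarefreeDegree s ↔ α = squarefreeDegree (s.erase t)) := by
        intro s α hts
        conv_lhs => rw [← Finset.insert_erase hts,
          squarefreeDegree_insert (Finset.notMem_erase t s), multiWeight]
        exact add_left_inj _
      have hshift' : ∀ {s : Finset (Fin n)} (α : Fin n →₀ ℕ), t ∉ s →
          α + multiWeight n t ≠ squarefreeDegree s := by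
        intro s α hts h
        have h1 := DFunLike.congr_fun h t
        rw [squarefreeDegree_apply, if_neg hts] at h1
        simp [multiWeight] at h1
      rw [squarefreeVeronese_insert K ht]
      refine ⟨F.cone G φ hφ hφε hφd hφ0 t fun p => mem_squarefreeVeronese_of_X_mul_mem ht,
        ?_, ?_⟩
      · rintro a ((b | b) | b)
        · obtain ⟨s, hs, hc, h⟩ := hG a b
          have hts : t ∉ s := fun h => ht (hs h)
          refine ⟨insert t s, Finset.insert_subset_insert t hs, ?_, ?_⟩
          · rw [Finset.card_insert_of_notMem hts, hc, add_assoc]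
          · rw [squarefreeDegree_insert hts, ← h]
            rfl
        · obtain ⟨s, hs, hc, h⟩ := hF a b
          exact ⟨s, hs.trans (Finset.subset_insert t T), hc, h⟩
        · cases a with
          | zero => exact isEmptyElim b
          | succ a =>
            obtain ⟨s, hs, hc, h⟩ := hF a b
            have hts : t ∉ s := fun h => ht (hs h)
            refine ⟨insert t s, Finset.insert_subset_insert t hs, ?_, ?_⟩
            · rw [Finset.card_insert_of_notMem hts, hc]
              omega
            · rw [squarefreeDegree_insert hts, ← h]
              rfl
      · intro a s hs hc
        refine (natCard_coneDeg F G t a _).trans ?_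
        by_cases hts : t ∈ s
        · have hs' : s.erase t ⊆ T := (Finset.subset_insert_iff).1 hs
          have hc' : (s.erase t).card = a + j := by
            rw [Finset.card_erase_of_mem hts, hc, ← add_assoc, Nat.add_sub_cancel]
          have hF0 : Nat.card {b // F.deg a b = squarefreeDegree s} = 0 := by
            refine Nat.card_eq_zero.2 (Or.inl ⟨fun b => ?_⟩)
            have h1 := DFunLike.congr_fun b.2 t
            rw [hFt, squarefreeDegree_apply, if_pos hts] at h1
            exact zero_ne_one h1
          simp only [hshift _ hts]
          rw [hGc a _ hs' hc', hF0, add_zero]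
          cases a with
          | zero =>
            rw [Nat.card_eq_zero.2 (Or.inl ⟨fun b => isEmptyElim b.1⟩)]
            simp
          | succ a =>
            have h1 : Nat.card {b // IndexedResolution.prevDeg F.deg (a + 1) b =
                squarefreeDegree (s.erase t)} = Nat.multichoose (j + 1) a :=
              hFc a _ hs' (by omega)
            rw [h1, Nat.multichoose_succ_succ]
        · have h1 : Nat.card {b // G.deg a b + multiWeight n t = squarefreeDegree s} = 0 :=
            Nat.card_eq_zero.2 (Or.inl ⟨fun b => hshift' _ hts b.2⟩)
          have h2 : Nat.card {b // IndexedResolution.prevDeg F.deg a b + multiWeight n t =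
              squarefreeDegree s} = 0 :=
            Nat.card_eq_zero.2 (Or.inl ⟨fun b => hshift' _ hts b.2⟩)
          rw [h1, h2, hFc a s ((Finset.subset_insert_iff_of_notMem hts).1 hs) hc]
          omega

/-! ### Coarsening the grading -/

theorem weight_comp {σ M M' : Type*} [AddCommMonoid M] [AddCommMonoid M'] (f : M →+ M')
    (w : σ → M) (e : σ →₀ ℕ) : Finsupp.weight (f ∘ w) e = f (Finsupp.weight w e) := by
  simp [Finsupp.weight_apply, Finsupp.sum]

theorem IsGradedMap.coarsen {σ K M M' A B : Type*} [Field K] [AddCommMonoid M]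
    [AddCommMonoid M'] [Fintype A] {w : σ → M} {δA : A → M} {δB : B → M}
    {g : (A → MvPolynomial σ K) →ₗ[MvPolynomial σ K] (B → MvPolynomial σ K)}
    (hg : IsGradedMap w δA δB g) (f : M →+ M') : IsGradedMap (f ∘ w) (f ∘ δA) (f ∘ δB) g := by
  classical
  rw [isGradedMap_iff] at hg ⊢
  intro a c e h
  rw [weight_comp, Function.comp_apply, ← map_add, hg a c e h, Function.comp_apply]

/-- A resolution stays a minimal graded free resolution when the degrees are mapped by an additive
homomorphism. -/
def IndexedResolution.coarsen {σ K M M' : Type*} [Field K] [AddCommMonoid M] [AddCommMonoid M']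
    {w : σ → M} {I : Ideal (MvPolynomial σ K)} (F : IndexedResolution w I) (f : M →+ M') :
    IndexedResolution (f ∘ w) I where
  ι := F.ι
  deg a := f ∘ F.deg a
  ε := F.ε
  d := F.d
  range_ε := F.range_ε
  exact_zero := F.exact_zero
  exact_succ := F.exact_succ
  isGradedMap_ε := by
    have h := F.isGradedMap_ε.coarsen f
    rwa [show f ∘ (fun _ : Unit => (0 : M)) = fun _ => 0 from funext fun _ => map_zero f] at h
  isGradedMap_d a := (F.isGradedMap_d a).coarsen f
  minimal := F.minimal

theorem degree_comp_multiWeight (n : ℕ) :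
    (Finsupp.degree : (Fin n →₀ ℕ) →+ ℕ) ∘ multiWeight n = stdWeight n := by
  funext t
  simp [multiWeight, stdWeight]

/-! ### Lcm-ideals of the failure ideals -/

theorem monomial_mem_kOutOfNIdeal {K : Type*} [Field K] {n k : ℕ} {β : Fin n →₀ ℕ} :
    monomial β (1 : K) ∈ kOutOfNIdeal K n k ↔ k ≤ β.support.card := by
  classical
  rw [← squarefreeVeronese_univ, mem_squarefreeVeronese]
  simp [coeff_monomial]

theorem support_squarefreeDegree {n : ℕ} (s : Finset (Fin n)) :
    (squarefreeDegree s).support = s := by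
  ext t
  simp [squarefreeDegree_apply]

theorem minMonomialGens_kOutOfNIdeal (K : Type*) [Field K] (n k : ℕ) :
    minMonomialGens (kOutOfNIdeal K n k) =
      squarefreeDegree '' {s : Finset (Fin n) | s.card = k} := by
  ext β
  simp only [minMonomialGens, monomial_mem_kOutOfNIdeal, Set.mem_ofPred_eq, Set.mem_image]
  constructor
  · intro h
    obtain ⟨s, hs, hc⟩ := Finset.exists_subset_card_eq h.prop
    exact ⟨s, hc, h.eq_of_le (by rw [support_squarefreeDegree, hc])
      (squarefreeDegree_le_iff.2 hs)⟩
  · rintro ⟨s, rfl, rfl⟩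
    refine ⟨(congrArg Finset.card (support_squarefreeDegree s)).ge, fun β hβ hle => ?_⟩
    have hsub : β.support ⊆ s := by
      rw [← support_squarefreeDegree s]
      exact Finsupp.support_mono hle
    exact squarefreeDegree_le_iff.2 (Finset.eq_of_subset_of_card_le hsub hβ).ge

theorem squarefreeDegree_union {n : ℕ} (s s' : Finset (Fin n)) :
    squarefreeDegree (s ⊔ s') = squarefreeDegree s ⊔ squarefreeDegree s' := by
  ext t
  rw [Finsupp.sup_apply]
  simp only [squarefreeDegree_apply, Finset.sup_eq_union, Finset.mem_union]
  by_cases h : t ∈ s <;> by_cases h' : t ∈ s' <;> simp [h, h']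

theorem sup_image_squarefreeDegree {n : ℕ} (A : Finset (Finset (Fin n))) :
    (A.image squarefreeDegree).sup id = squarefreeDegree (A.sup id) := by
  rw [Finset.sup_image, Finset.apply_sup_eq_sup_comp _ squarefreeDegree_union rfl]
  rfl

/-- More than `(j - 1).choose k` sets of cardinality `k` have a union with at least `j`
elements. -/
theorem le_card_sup_of_choose_lt {α : Type*} [DecidableEq α] {A : Finset (Finset α)} {j k : ℕ}
    (hA : ∀ s ∈ A, s.card = k) (h : (j - 1).choose k < A.card) : j ≤ (A.sup id).card := by
  by_contra! hlt
  have h1 : A ⊆ (A.sup id).powersetCard k := fun s hs =>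
    Finset.mem_powersetCard.2 ⟨Finset.le_sup (f := id) hs, hA s hs⟩
  have h2 := Finset.card_le_card h1
  rw [Finset.card_powersetCard] at h2
  have h3 := Nat.choose_le_choose k (show (A.sup id).card ≤ j - 1 by omega)
  omega

/-- The `i`-fold lcm-ideal of the failure ideal of the `k`-out-of-`n` system is the failure ideal
of the `j`-out-of-`n` system: a union of `i` sets of cardinality `k` has at least `j` elements, and
each set of cardinality `j` is such a union. -/
theorem lcmIdeal_kOutOfNIdeal (K : Type*) [Field K] {n k j i : ℕ} (hi₁ : (j - 1).choose k < i)
    (hi₂ : i ≤ j.choose k) : lcmIdeal (kOutOfNIdeal K n k) i = kOutOfNIdeal K n j := by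
  apply le_antisymm
  · refine Ideal.span_le.2 ?_
    rintro _ ⟨s, hs, hc, rfl⟩
    rw [minMonomialGens_kOutOfNIdeal] at hs
    obtain ⟨A, hA, rfl⟩ := Finset.subset_set_image_iff.1 hs
    rw [Finset.card_image_of_injective _ squarefreeDegree_injective] at hc
    rw [SetLike.mem_coe, monomial_mem_kOutOfNIdeal, sup_image_squarefreeDegree,
      support_squarefreeDegree]
    exact le_card_sup_of_choose_lt (fun s hs => hA hs) (hc ▸ hi₁)
  · refine Ideal.span_le.2 ?_
    rintro _ ⟨s, hs, rfl⟩
    obtain ⟨A, hA, hc⟩ := Finset.exists_subset_card_eq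
      (show i ≤ (s.powersetCard k).card by rwa [Finset.card_powersetCard, hs])
    have hAk : ∀ u ∈ A, u.card = k := fun u hu => (Finset.mem_powersetCard.1 (hA hu)).2
    have hsup : A.sup id = s := by
      refine Finset.eq_of_subset_of_card_le (Finset.sup_le fun u hu =>
        (Finset.mem_powersetCard.1 (hA hu)).1) ?_
      rw [hs]
      exact le_card_sup_of_choose_lt hAk (hc.symm ▸ hi₁)
    refine Ideal.subset_span ⟨A.image squarefreeDegree, ?_, ?_, ?_⟩
    · rw [minMonomialGens_kOutOfNIdeal, Finset.coe_image]
      exact Set.image_mono fun u hu => hAk u hu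
    · rw [Finset.card_image_of_injective _ squarefreeDegree_injective, hc]
    · rw [sup_image_squarefreeDegree, hsup, prod_X_eq_monomial]

/-! ### The Betti numbers -/

theorem multichoose_eq_choose {j : ℕ} (hj : 1 ≤ j) (a : ℕ) :
    Nat.multichoose j a = (a + j - 1).choose (j - 1) := by
  rw [Nat.multichoose_eq, add_comm j a]
  exact Nat.choose_symm_of_eq_add (by omega)

theorem IndexedResolution.hasBettiNumber {σ K M : Type*} [Field K] [AddCommMonoid M] {w : σ → M}
    {I : Ideal (MvPolynomial σ K)} (F : IndexedResolution w I) {a : ℕ} {m : M} {c : ℕ}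
    (h : Nat.card {b // F.deg a b = m} = c) : HasBettiNumber w I a m c := by
  rw [← h, ← F.numGens_toMinimalGradedFreeResolution]
  exact hasBettiNumber_of_resolution _ a m

theorem IndexedResolution.hasBettiNumber_zero {σ K M : Type*} [Field K] [AddCommMonoid M]
    {w : σ → M} {I : Ideal (MvPolynomial σ K)} (F : IndexedResolution w I) {a : ℕ} {m : M}
    (h : ∀ b, F.deg a b ≠ m) : HasBettiNumber w I a m 0 :=
  F.hasBettiNumber (Nat.card_eq_zero.2 (Or.inl ⟨fun b => h b.1 b.2⟩))

/-- If one minimal resolution is linear, then all of them are. -/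
theorem IndexedResolution.hasLinearResolution {K : Type*} [Field K] {n j : ℕ}
    {I : Ideal (MvPolynomial (Fin n) K)} (F : IndexedResolution (stdWeight n) I)
    (h : ∀ a b, F.deg a b = a + j) : HasLinearResolution I j := by
  refine ⟨⟨F.toMinimalGradedFreeResolution⟩, fun F' a b => ?_⟩
  by_contra hne
  have h0 : F'.numGens a (F'.deg a b) = 0 :=
    (F.hasBettiNumber_zero fun b' => h a b' ▸ Ne.symm hne).2 F'
  rcases Nat.card_eq_zero.1 h0 with h1 | h1
  · exact h1.false ⟨b, rfl⟩
  · exact h1.not_finite inferInstance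

theorem card_index_eq {K : Type*} [Field K] {n j c : ℕ} {I : Ideal (MvPolynomial (Fin n) K)}
    (F : IndexedResolution (multiWeight n) I) (a : ℕ)
    (h : ∀ b, ∃ s : Finset (Fin n), s.card = a + j ∧ F.deg a b = squarefreeDegree s)
    (hc : ∀ s : Finset (Fin n), s.card = a + j →
      Nat.card {b // F.deg a b = squarefreeDegree s} = c) :
    Fintype.card (F.ι a) = n.choose (j + a) * c := by
  classical
  rw [← Finset.card_univ, Finset.card_eq_sum_card_fiberwise (f := F.deg a)
    (t := (Finset.univ.powersetCard (a + j)).image squarefreeDegree)]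
  · rw [Finset.sum_image squarefreeDegree_injective.injOn, Finset.sum_const_nat (m := c)]
    · rw [Finset.card_powersetCard, Finset.card_univ, Fintype.card_fin, add_comm a j]
    · intro s hs
      rw [← hc s (Finset.mem_powersetCard.1 hs).2, Nat.card_eq_fintype_card, Fintype.card_subtype]
  · intro b _
    obtain ⟨s, hs, hb⟩ := h b
    simpa [hb] using ⟨s, hs, rfl⟩

theorem mainTheorem3 (K : Type*) [Field K] (n k j i : ℕ) (hk : 1 ≤ k) (hjn : j ≤ n)
    (hi₁ : (j - 1).choose k < i) (hi₂ : i ≤ j.choose k)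
    (I : Ideal (MvPolynomial (Fin n) K))
    (hI : I = lcmIdeal (kOutOfNIdeal K n k) i ∨ I = kOutOfNIdeal K n j) :
    HasLinearResolution I j ∧
    (∀ a : ℕ, a ≤ n - j →
      HasGradedBetti I a (a + j) (n.choose (j + a) * (a + j - 1).choose (j - 1))) ∧
    (∀ a b : ℕ, ¬ (a ≤ n - j ∧ b = a + j) → HasGradedBetti I a b 0) ∧
    (∀ (a : ℕ) (s : Finset (Fin n)), s.card = a + j →
      HasMultigradedBetti I a (squarefreeDegree s) ((a + j - 1).choose (j - 1))) ∧
    (∀ (a : ℕ) (α : Fin n →₀ ℕ), (¬ ∃ s : Finset (Fin n), s.card = a + j ∧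
      α = squarefreeDegree s) → HasMultigradedBetti I a α 0) := by
  have hj : 1 ≤ j := by
    by_contra! h
    obtain rfl : j = 0 := by omega
    rw [Nat.choose_eq_zero_of_lt hk] at hi₂
    omega
  have hI' : I = squarefreeVeronese K Finset.univ j := by
    rw [squarefreeVeronese_univ]
    rcases hI with rfl | rfl
    · exact lcmIdeal_kOutOfNIdeal K hi₁ hi₂
    · rfl
  subst hI'
  obtain ⟨F, hF, hFc⟩ := exists_resolution_squarefreeVeronese K (Finset.univ : Finset (Fin n)) j
  have hF' : ∀ a b, ∃ s : Finset (Fin n), s.card = a + j ∧ F.deg a b = squarefreeDegree s :=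
    fun a b => (hF a b).imp fun s hs => hs.2
  have hFc' : ∀ a (s : Finset (Fin n)), s.card = a + j →
      Nat.card {b // F.deg a b = squarefreeDegree s} = (a + j - 1).choose (j - 1) :=
    fun a s hs => (hFc a s (Finset.subset_univ s) hs).trans (multichoose_eq_choose hj a)
  obtain ⟨G, e, hG⟩ : ∃ (G : IndexedResolution (stdWeight n) (squarefreeVeronese K Finset.univ j))
      (e : ∀ a, G.ι a ≃ F.ι a), ∀ a b, G.deg a b = (F.deg a (e a b)).degree := by
    rw [← degree_comp_multiWeight]
    exact ⟨F.coarsen Finsupp.degree, fun a => Equiv.refl _, fun a b => rfl⟩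
  have hGdeg : ∀ a b, G.deg a b = a + j := fun a b => by
    obtain ⟨s, hs, h⟩ := hF' a (e a b)
    rw [hG, h, degree_squarefreeDegree, hs]
  refine ⟨G.hasLinearResolution hGdeg, fun a _ => G.hasBettiNumber ?_, fun a b hab => ?_,
    fun a s hs => F.hasBettiNumber (hFc' a s hs), fun a α hα => F.hasBettiNumber_zero fun b h => ?_⟩
  · rw [← card_index_eq F a (hF' a) (hFc' a), ← Nat.card_eq_fintype_card, ← Nat.card_congr (e a)]
    exact Nat.card_congr (Equiv.subtypeUnivEquiv (hGdeg a))
  · refine G.hasBettiNumber_zero fun c hc => hab ⟨?_, hc ▸ hGdeg a c⟩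
    obtain ⟨s, hs, -⟩ := hF' a (e a c)
    have := Finset.card_le_univ s
    rw [Fintype.card_fin] at this
    omega
  · obtain ⟨s, hs, hb⟩ := hF' a b
    exact hα ⟨s, hs, h ▸ hb⟩
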